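/- Let $p$ be a prime, $N$ a positive integer coprime to $p$, and $k$ a positive even integer. Let $\mathcal{S}_k(\Gamma_0(M))$ denote the complex vector space of cusp forms of weight $k$ for $\Gamma_0(M)$, and let $W_p$ be the Atkin–Lehner involution at $p$ on $\mathcal{S}_k(\Gamma_0(pN))$, i.e. $(W_pf)(z)=p^{k/2}(pNc\,z+pd)^{-k}f\!\left(\frac{pa z+b}{pNcz+pd}\right)$ for any integers $a,b,c,d$ with $p^2ad-pNbc=p$ (the operator does not depend on the choice). Let $\mathcal{S}_k(\Gamma_0(pN))^{p-\mathrm{new}}$ be the orthogonal complement, with respect to the Petersson inner product, of the $p$-old subspace, which is spanned by the forms $f(z)$ and $f(pz)$ with $f\in\mathcal{S}_k(\Gamma_0(N))$. Then $\mathcal{S}_k(\Gamma_0(pN))$ is finite dimensional, and for every eigenvalue $\varepsilon$ of $W_p$ on $\mathcal{S}_k(\Gamma_0(pN))$ the dimension $d_\varepsilon$ of $\{f\in\mathcal{S}_k(\Gamma_0(pN))^{p-\mathrm{new}} : W_pf=\varepsilon f\}$ is $$d_\varepsilon=\frac12\left(d+\varepsilon\,\mathrm{tr}\big(W_p\mid\mathcal{S}_k(\Gamma_0(pN))\big)\right),\qquad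 d:=\dim\mathcal{S}_k(\Gamma_0(pN))^{p-\mathrm{new}}.$$ -/

import Mathlib

open UpperHalfPlane MeasureTheory CongruenceSubgroup
open scoped MatrixGroups ModularForm Modular

noncomputable section

namespace AtkinLehner

/-- The congruence subgroup `Γ₀(M)`, viewed inside `GL(2, ℝ)`. -/
abbrev Gamma0GL (M : ℕ) : Subgroup (GL (Fin 2) ℝ) :=
  (Gamma0 M).map (Matrix.SpecialLinearGroup.mapGL ℝ)

/-- `S_k(Γ₀(M))`, the complex vector space of cusp forms of weight `k` and level `Γ₀(M)`. -/
abbrev CuspSpace (M : ℕ) (k : ℤ) : Type := CuspForm (Gamma0GL M) k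

/-! ### Slash operators between spaces of cusp forms -/

open scoped Pointwise in
/-- If `det g > 0` and `g Γ' g⁻¹ ⊆ Γ`, then `f ↦ f ∣[k] g` is a linear map from cusp forms for `Γ`
to cusp forms for `Γ'`. Mathlib's normalisation is
`(f ∣[k] g) z = (det g) ^ (k - 1) * (c z + d) ^ (-k) * f (g z)`. -/
def slashMap {Γ Γ' : Subgroup (GL (Fin 2) ℝ)} [Γ.HasDetOne] [Γ'.HasDetOne] (k : ℤ)
    (g : GL (Fin 2) ℝ) (hg : 0 < g.det.val) (h : ∀ γ ∈ Γ', g * γ * g⁻¹ ∈ Γ) :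
    CuspForm Γ k →ₗ[ℂ] CuspForm Γ' k where
  toFun f :=
    { toFun := ⇑f ∣[k] g
      slash_action_eq' := fun γ hγ => by
        have h1 := SlashInvariantFormClass.slash_action_eq f _ (h γ hγ)
        rw [← SlashAction.slash_mul]
        conv_rhs => rw [← h1]
        rw [← SlashAction.slash_mul]
        simp
      holo' := f.holo'.slash k g
      zero_at_cusps' := fun {c} hc => by
        have h2 : Γ' ≤ ConjAct.toConjAct g⁻¹ • Γ := fun γ hγ => by
          rw [map_inv, Γ.mem_inv_pointwise_smul_iff, ConjAct.toConjAct_smul]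
          exact h γ hγ
        exact (CuspForm.translate f g).zero_at_cusps' (hc.mono h2) }
  map_add' f₁ f₂ := by
    ext z
    exact congrFun (SlashAction.add_slash k g (⇑f₁) (⇑f₂)) z
  map_smul' a f := by
    have h3 := ModularForm.smul_slash k g (⇑f) a
    have hs : σ g a = a := by
      unfold UpperHalfPlane.σ
      rw [if_pos hg]
      rfl
    rw [hs] at h3
    ext z
    exact congrFun h3 z

@[simp]
lemma coe_slashMap {Γ Γ' : Subgroup (GL (Fin 2) ℝ)} [Γ.HasDetOne] [Γ'.HasDetOne] (k : ℤ)
    (g : GL (Fin 2) ℝ) (hg : 0 < g.det.val) (h : ∀ γ ∈ Γ', g * γ * g⁻¹ ∈ Γ) (f : CuspForm Γ k) :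
    ⇑(slashMap k g hg h f) = ⇑f ∣[k] g := rfl

/-! ### The `p`-old subspace -/

lemma mem_Gamma0GL_iff {M : ℕ} {g : GL (Fin 2) ℝ} :
    g ∈ Gamma0GL M ↔ ∃ a b c d : ℤ, a * d - b * (M * c) = 1 ∧
      g.val = !![(a : ℝ), b; (M : ℝ) * c, d] := by
  constructor
  · rintro ⟨γ, hγ, rfl⟩
    have h0 : ((γ 1 0 : ℤ) : ZMod M) = 0 := Gamma0_mem.mp hγ
    obtain ⟨c, hc⟩ := (ZMod.intCast_zmod_eq_zero_iff_dvd _ _).mp h0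
    refine ⟨γ 0 0, γ 0 1, c, γ 1 1, ?_, ?_⟩
    · have := γ.det_coe
      rw [Matrix.det_fin_two, hc] at this
      exact this
    · ext i j
      fin_cases i <;> fin_cases j <;> simp [hc]
  · rintro ⟨a, b, c, d, hdet, hg⟩
    refine ⟨⟨!![a, b; M * c, d], by rw [Matrix.det_fin_two_of]; exact hdet⟩, ?_, ?_⟩
    · exact Gamma0_mem.mpr (by simp)
    · apply Units.ext
      rw [hg]
      ext i j
      fin_cases i <;> fin_cases j
      · rfl
      · rfl
      · change (((M : ℤ) * c : ℤ) : ℝ) = (M : ℝ) * c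
        push_cast
        rfl
      · rfl

/-- The matrix `diag(p, 1)`. -/
def diagMatrix (p : ℕ) [Fact p.Prime] : GL (Fin 2) ℝ :=
  Matrix.GeneralLinearGroup.mkOfDetNeZero !![(p : ℝ), 0; 0, 1]
    (by simp [(Fact.out : p.Prime).ne_zero])

lemma diagMatrix_det_pos (p : ℕ) [Fact p.Prime] : 0 < (diagMatrix p).det.val := by
  have : 0 < p := (Fact.out : p.Prime).pos
  simpa [diagMatrix, Matrix.GeneralLinearGroup.mkOfDetNeZero, Matrix.det_fin_two_of] using this

lemma diagMatrix_conj (p N : ℕ) [Fact p.Prime] :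
    ∀ γ ∈ Gamma0GL (p * N), diagMatrix p * γ * (diagMatrix p)⁻¹ ∈ Gamma0GL N := by
  intro γ hγ
  obtain ⟨a, b, c, d, hdet, hγ'⟩ := mem_Gamma0GL_iff.mp hγ
  refine mem_Gamma0GL_iff.mpr ⟨a, p * b, c, d, ?_, ?_⟩
  · push_cast at hdet
    linear_combination hdet
  · have key : (diagMatrix p * γ).val = (!![(a : ℝ), (p * b : ℤ); (N : ℝ) * c, d]
        * (diagMatrix p).val) := by
      rw [Units.val_mul, hγ']
      ext i j
      fin_cases i <;> fin_cases j <;>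
        simp [diagMatrix, Matrix.GeneralLinearGroup.mkOfDetNeZero, Matrix.mul_apply,
          Fin.sum_univ_two] <;> ring
    rw [Units.val_mul, key, mul_assoc, ← Units.val_mul, mul_inv_cancel, Units.val_one, mul_one]

/-- The inclusion `S_k(Γ₀(N)) → S_k(Γ₀(pN))`, `f(z) ↦ f(z)`. -/
def oldIncl (p N : ℕ) (k : ℤ) : CuspSpace N k →ₗ[ℂ] CuspSpace (p * N) k :=
  slashMap k 1 (by simp) (fun γ hγ => by
    obtain ⟨a, b, c, d, hdet, hγ'⟩ := mem_Gamma0GL_iff.mp hγ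
    refine mem_Gamma0GL_iff.mpr ⟨a, b, p * c, d, ?_, ?_⟩
    · push_cast at hdet
      linear_combination hdet
    · simp [hγ']
      ring)

@[simp]
lemma oldIncl_apply (p N : ℕ) (k : ℤ) (f : CuspSpace N k) (z : ℍ) : oldIncl p N k f z = f z := by
  simp [oldIncl]

/-- The degeneracy map `S_k(Γ₀(N)) → S_k(Γ₀(pN))`, `f(z) ↦ f(pz)`. -/
def oldScale (p N : ℕ) [Fact p.Prime] (k : ℤ) : CuspSpace N k →ₗ[ℂ] CuspSpace (p * N) k :=
  (p : ℂ) ^ (1 - k) • slashMap k (diagMatrix p) (diagMatrix_det_pos p) (diagMatrix_conj p N)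

lemma oldScale_apply (p N : ℕ) [Fact p.Prime] (k : ℤ) (f : CuspSpace N k) (z : ℍ) :
    oldScale p N k f z = f ((⟨p, by exact_mod_cast (Fact.out : p.Prime).pos⟩ : {x : ℝ // 0 < x})
      • z) := by
  have hp : (p : ℂ) ≠ 0 := by exact_mod_cast (Fact.out : p.Prime).ne_zero
  have hz : diagMatrix p • z = (⟨p, by exact_mod_cast (Fact.out : p.Prime).pos⟩ :
      {x : ℝ // 0 < x}) • z := by
    ext1
    rw [coe_smul_of_det_pos (diagMatrix_det_pos p)]
    simp [diagMatrix, Matrix.GeneralLinearGroup.mkOfDetNeZero, num, denom]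
  have hs : ∀ w, σ (diagMatrix p) w = w := fun w => by
    unfold UpperHalfPlane.σ
    rw [if_pos (diagMatrix_det_pos p)]
    rfl
  have hd : denom (diagMatrix p) z = 1 := by
    simp [diagMatrix, Matrix.GeneralLinearGroup.mkOfDetNeZero, denom]
  have hdet : (diagMatrix p).det.val = p := by
    simp [diagMatrix, Matrix.GeneralLinearGroup.mkOfDetNeZero, Matrix.det_fin_two_of]
  change (p : ℂ) ^ (1 - k) * (⇑f ∣[k] diagMatrix p) z = _
  rw [ModularForm.slash_apply, hs, hd, hz, hdet, one_zpow, mul_one, Nat.abs_cast,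
    mul_comm (f _), ← mul_assoc, Complex.ofReal_natCast, ← zpow_add₀ hp]
  simp

/-- The `p`-old subspace of `S_k(Γ₀(pN))`: the span of all `f(z)` and `f(pz)`,
`f ∈ S_k(Γ₀(N))`. -/
def pOld (p N : ℕ) [Fact p.Prime] (k : ℤ) : Submodule ℂ (CuspSpace (p * N) k) :=
  LinearMap.range (oldIncl p N k) ⊔ LinearMap.range (oldScale p N k)

/-! ### The Petersson inner product and the `p`-new subspace -/

/-- The (unnormalised) Petersson product
`⟨f, g⟩ = ∫_{Γ₀(M) \ ℍ} conj (f z) * g z * y ^ k dx dy / y ^ 2`. The integral over `Γ₀(M) \ ℍ` is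
computed on the fundamental domain formed by the translates `r⁻¹ 𝒟` of the standard fundamental
domain `𝒟` of `SL(2, ℤ)`, where `r` runs through representatives of `SL(2, ℤ) / Γ₀(M)`;
`volume` on `ℍ` is the invariant measure `dx dy / y ^ 2`. -/
def peterssonProduct {M : ℕ} {k : ℤ} (f g : CuspSpace M k) : ℂ :=
  ∑ᶠ q : SL(2, ℤ) ⧸ Gamma0 M, ∫ τ in 𝒟, petersson k f g (q.out⁻¹ • τ)

lemma volume_fd_lt_top : (volume : Measure ℍ) 𝒟 < ⊤ := by
  rw [volume_eq_lintegral]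
  have hsub : UpperHalfPlane.coe '' 𝒟 ⊆ Complex.measurableEquivRealProd ⁻¹'
      (Set.Icc (-1) 1 ×ˢ Set.Ioi (1 / 2 : ℝ)) := by
    rintro _ ⟨z, hz, rfl⟩
    have h1 := ModularGroup.three_le_four_mul_im_sq_of_mem_fd hz
    have h2 : |z.re| ≤ 1 / 2 := hz.2
    rw [abs_le] at h2
    have h3 := z.im_pos
    simp only [Set.mem_preimage, Complex.measurableEquivRealProd_apply, Set.mem_prod, Set.mem_Icc,
      Set.mem_Ioi, coe_re, coe_im]
    refine ⟨⟨by linarith, by linarith⟩, by nlinarith⟩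
  refine (lintegral_mono_set hsub).trans_lt ?_
  have hmp := Complex.volume_preserving_equiv_real_prod
  have h4 := hmp.setLIntegral_comp_preimage_emb Complex.measurableEquivRealProd.measurableEmbedding
    (fun x : ℝ × ℝ => (((1 / ‖x.2‖₊) ^ 2 : NNReal) : ENNReal))
    (Set.Icc (-1) 1 ×ˢ Set.Ioi (1 / 2 : ℝ))
  simp only [Complex.measurableEquivRealProd_apply] at h4
  rw [h4, Measure.volume_eq_prod, ← Measure.prod_restrict, lintegral_prod _ (by fun_prop)]
  simp only [lintegral_const, Measure.restrict_apply MeasurableSet.univ, Set.univ_inter,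
    Real.volume_Icc]
  refine ENNReal.mul_lt_top ?_ ENNReal.ofReal_lt_top
  have h5 : IntegrableOn (fun t : ℝ => t ^ (-2 : ℝ)) (Set.Ioi (1 / 2 : ℝ)) :=
    integrableOn_Ioi_rpow_of_lt (by norm_num) (by norm_num)
  refine lt_of_le_of_lt (setLIntegral_mono' measurableSet_Ioi fun t ht => ?_) h5.2
  have ht0 : 0 < t := lt_trans (by norm_num) ht
  rw [enorm_eq_nnnorm]
  refine ENNReal.coe_le_coe.mpr (le_of_eq ?_)
  ext
  simp [Real.rpow_neg ht0.le, abs_of_pos ht0]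

lemma integrable_petersson {M : ℕ} [NeZero M] {k : ℤ} (f g : CuspSpace M k) (γ : SL(2, ℤ)) :
    IntegrableOn (fun τ => petersson k f g (γ • τ)) 𝒟 := by
  obtain ⟨C, hC⟩ := CuspFormClass.petersson_bounded_left k (Gamma0GL M) f g
  have hf : Continuous f := ModularFormClass.continuous f
  have hg : Continuous g := ModularFormClass.continuous g
  have hc : Continuous fun τ : ℍ => petersson k f g (γ • τ) :=
    (petersson_continuous k hf hg).comp (continuous_const_smul (Matrix.SpecialLinearGroup.mapGL ℝ γ))
  exact Measure.integrableOn_of_bounded volume_fd_lt_top.ne hc.aestronglyMeasurable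
    (ae_of_all _ fun τ => hC _)

lemma peterssonProduct_eq_sum {M : ℕ} [NeZero M] {k : ℤ} (f g : CuspSpace M k) :
    letI := Fintype.ofFinite (SL(2, ℤ) ⧸ Gamma0 M)
    peterssonProduct f g =
      ∑ q : SL(2, ℤ) ⧸ Gamma0 M, ∫ τ in 𝒟, petersson k f g (q.out⁻¹ • τ) :=
  letI := Fintype.ofFinite (SL(2, ℤ) ⧸ Gamma0 M)
  finsum_eq_sum_of_fintype _

lemma peterssonProduct_add {M : ℕ} [NeZero M] {k : ℤ} (f g₁ g₂ : CuspSpace M k) :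
    peterssonProduct f (g₁ + g₂) = peterssonProduct f g₁ + peterssonProduct f g₂ := by
  simp only [peterssonProduct_eq_sum, ← Finset.sum_add_distrib]
  refine Finset.sum_congr rfl fun q _ => ?_
  rw [← integral_add (integrable_petersson f g₁ _) (integrable_petersson f g₂ _)]
  refine integral_congr_ae (ae_of_all _ fun τ => ?_)
  simp only [petersson, FunLike.coe_add, Pi.add_apply]
  ring

lemma peterssonProduct_smul {M : ℕ} [NeZero M] {k : ℤ} (a : ℂ) (f g : CuspSpace M k) :
    peterssonProduct f (a • g) = a * peterssonProduct f g := by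
  simp only [peterssonProduct_eq_sum, Finset.mul_sum]
  refine Finset.sum_congr rfl fun q _ => ?_
  rw [← integral_const_mul]
  refine integral_congr_ae (ae_of_all _ fun τ => ?_)
  simp only [petersson, FunLike.coe_smul, Pi.smul_apply, smul_eq_mul]
  ring

/-- The `p`-new subspace of `S_k(Γ₀(pN))`: the orthogonal complement of the `p`-old subspace with
respect to the Petersson product. -/
def pNew (p N : ℕ) [Fact p.Prime] [NeZero N] (k : ℤ) : Submodule ℂ (CuspSpace (p * N) k) where
  carrier := {f | ∀ h ∈ pOld p N k, peterssonProduct h f = 0}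
  add_mem' := fun {f g} hf hg h hh => by
    have : NeZero p := ⟨(Fact.out : p.Prime).ne_zero⟩
    rw [peterssonProduct_add, hf h hh, hg h hh, add_zero]
  zero_mem' := fun h _ => by
    have : NeZero p := ⟨(Fact.out : p.Prime).ne_zero⟩
    simpa using peterssonProduct_smul 0 h 0
  smul_mem' := fun a f hf h hh => by
    have : NeZero p := ⟨(Fact.out : p.Prime).ne_zero⟩
    rw [peterssonProduct_smul, hf h hh, mul_zero]

/-! ### The Atkin-Lehner involution at `p` -/

/-- A matrix `(p x, -y; p N, p)` of determinant `p`, where `x` and `y` are the Bézout coefficients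
with `p x + N y = gcd(p, N) = 1`. -/
def alMatrix (p N : ℕ) [Fact p.Prime] (hpN : p.Coprime N) : GL (Fin 2) ℝ :=
  Matrix.GeneralLinearGroup.mkOfDetNeZero
    !![(p : ℝ) * (p.gcdA N : ℝ), -(p.gcdB N : ℝ); (p : ℝ) * N, p]
    (by
      have h : (p : ℝ) * p.gcdA N + N * p.gcdB N = 1 := by
        have := Nat.gcd_eq_gcd_ab p N
        rw [hpN] at this
        exact_mod_cast this.symm
      have hp : (p : ℝ) ≠ 0 := by exact_mod_cast (Fact.out : p.Prime).ne_zero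
      rw [Matrix.det_fin_two_of]
      intro h0
      exact hp (by linear_combination h0 - (p : ℝ) * h))

lemma bezout_eq {p N : ℕ} (hpN : p.Coprime N) : (p : ℤ) * p.gcdA N + N * p.gcdB N = 1 := by
  have := Nat.gcd_eq_gcd_ab p N
  rw [hpN] at this
  exact_mod_cast this.symm

lemma alMatrix_det (p N : ℕ) [Fact p.Prime] (hpN : p.Coprime N) :
    (alMatrix p N hpN).det.val = p := by
  have h : (p : ℝ) * p.gcdA N + N * p.gcdB N = 1 := by exact_mod_cast bezout_eq hpN
  have h' : (alMatrix p N hpN).det.val =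
      (!![(p : ℝ) * (p.gcdA N : ℝ), -(p.gcdB N : ℝ); (p : ℝ) * N, p]).det := rfl
  rw [h', Matrix.det_fin_two_of]
  linear_combination (p : ℝ) * h

lemma alMatrix_conj (p N : ℕ) [Fact p.Prime] (hpN : p.Coprime N) :
    ∀ γ ∈ Gamma0GL (p * N), alMatrix p N hpN * γ * (alMatrix p N hpN)⁻¹ ∈ Gamma0GL (p * N) := by
  intro γ hγ
  obtain ⟨a, b, c, d, hdet, hγ'⟩ := mem_Gamma0GL_iff.mp hγ
  have h := bezout_eq hpN
  set x := p.gcdA N with hx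
  set y := p.gcdB N with hy
  have hR : (p : ℝ) * x + N * y = 1 := by exact_mod_cast h
  have key : (alMatrix p N hpN * γ).val =
      !![((p * x * a - p * N * y * c - p * N * x * b + N * y * d : ℤ) : ℝ),
          ((x * y * a - y ^ 2 * N * c + p * x ^ 2 * b - x * y * d : ℤ) : ℝ);
        ((p * N : ℕ) : ℝ) * ((a + p * c - N * b - d : ℤ) : ℝ),
          ((N * y * a + p * N * y * c + p * N * x * b + p * x * d : ℤ) : ℝ)]
        * (alMatrix p N hpN).val := by
    rw [Units.val_mul, hγ']
    ext i j
    fin_cases i <;> fin_cases j <;>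
      simp [alMatrix, Matrix.GeneralLinearGroup.mkOfDetNeZero, Matrix.mul_apply,
        Fin.sum_univ_two, ← hx, ← hy]
    · linear_combination (-(p * x * a - y * (p * N * c)) : ℝ) * hR
    · linear_combination (-(p * x * b - y * d) : ℝ) * hR
    · linear_combination (-(p * N * a + p * (p * N * c)) : ℝ) * hR
    · linear_combination (-(p * N * b + p * d) : ℝ) * hR
  refine mem_Gamma0GL_iff.mpr ⟨p * x * a - p * N * y * c - p * N * x * b + N * y * d,
    x * y * a - y ^ 2 * N * c + p * x ^ 2 * b - x * y * d, a + p * c - N * b - d,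
    N * y * a + p * N * y * c + p * N * x * b + p * x * d, ?_, ?_⟩
  · push_cast at hdet ⊢
    linear_combination ((p * x + N * y) ^ 2 : ℤ) * hdet + (p * x + N * y + 1 : ℤ) * h
  · rw [Units.val_mul, key, mul_assoc, ← Units.val_mul, mul_inv_cancel, Units.val_one, mul_one]

/-- The Atkin-Lehner involution `W_p` on `S_k(Γ₀(pN))`: with `g` the matrix `alMatrix p N` of
determinant `p` and lower row `(c, d)`, it is
`(W_p f)(z) = p ^ (k / 2) * (c z + d) ^ (-k) * f (g z)`. (The weight `k` is even; the factor
`p ^ (1 - k / 2)` corrects Mathlib's normalisation of the slash operator, which has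
`p ^ (k - 1)` in place of `p ^ (k / 2)`.) -/
def atkinLehner (p N : ℕ) [Fact p.Prime] (hpN : p.Coprime N) (k : ℤ) :
    Module.End ℂ (CuspSpace (p * N) k) :=
  (p : ℂ) ^ (1 - k / 2) • slashMap k (alMatrix p N hpN)
    (by rw [alMatrix_det]; exact_mod_cast (Fact.out : p.Prime).pos) (alMatrix_conj p N hpN)

lemma atkinLehner_apply (p N : ℕ) [Fact p.Prime] (hpN : p.Coprime N) (k : ℤ) (hk : Even k)
    (f : CuspSpace (p * N) k) (z : ℍ) :
    atkinLehner p N hpN k f z =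
      (p : ℂ) ^ (k / 2) * ((p : ℂ) * N * z + p) ^ (-k) * f (alMatrix p N hpN • z) := by
  have hp : (p : ℂ) ≠ 0 := by exact_mod_cast (Fact.out : p.Prime).ne_zero
  have hs : ∀ w, σ (alMatrix p N hpN) w = w := fun w => by
    unfold UpperHalfPlane.σ
    rw [if_pos (by rw [alMatrix_det]; exact_mod_cast (Fact.out : p.Prime).pos)]
    rfl
  have hd : denom (alMatrix p N hpN) z = (p : ℂ) * N * z + p := by
    simp [alMatrix, Matrix.GeneralLinearGroup.mkOfDetNeZero, denom]
  have hpow : (p : ℂ) ^ (1 - k / 2) * (p : ℂ) ^ (k - 1) = (p : ℂ) ^ (k / 2) := by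
    rw [← zpow_add₀ hp]
    congr 1
    obtain ⟨m, rfl⟩ := hk
    omega
  change (p : ℂ) ^ (1 - k / 2) * (⇑f ∣[k] alMatrix p N hpN) z = _
  rw [ModularForm.slash_apply, hs, hd, alMatrix_det, Nat.abs_cast, Complex.ofReal_natCast, ← hpow]
  ring

end AtkinLehner
end

/-! Write `W` for `W_p`. Three facts suffice: the space is the direct sum of its `p`-old and `p`-new
parts, `W` is an involution preserving both parts, and `W` has trace zero on the old part. Then `tr
W` is its trace on the new part, where `(1 + εW)/2` projects onto the `ε`-eigenspace; the rank of a
projection is its trace, which gives the formula.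

Trace zero: `f(z) + g(pz)` determines the pair `(f, g)`, so the old part is two copies of
`S_k(Γ₀(N))`, and `W` exchanges the copies up to scalars (`trace_atkinLehner_pOld`).

Direct sum: the space is finite dimensional, because a Sturm bound applied to norms down to level
one makes finitely many `q`-coefficients determine a form, and the Petersson product is positive
definite (`isCompl_pOld_pNew`).

Stability of the new part: the matrix of `W` normalises `Γ₀(pN)`, so `W` is a Petersson isometry
(`peterssonProduct_atkinLehner`); an isometry that maps the old part to itself and squares to one
also maps the orthogonal complement to itself. -/

/-- If an involution `W` preserves complementary subspaces `O` and `N` and is traceless on `O`, its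
trace determines the dimensions of its eigenspaces on `N`. -/
theorem LinearMap.finrank_inf_eigenspace_of_involutive {V : Type*} [AddCommGroup V] [Module ℂ V]
    [FiniteDimensional ℂ V] (W : Module.End ℂ V) (hW : ∀ x, W (W x) = x) {O N : Submodule ℂ V}
    (h : IsCompl O N) (hO : ∀ x ∈ O, W x ∈ O) (hN : ∀ x ∈ N, W x ∈ N)
    (htr : LinearMap.trace ℂ O (W.restrict hO) = 0) {ε : ℂ} (hε : ε * ε = 1) :
    (Module.finrank ℂ ↥(N ⊓ Module.End.eigenspace W ε) : ℂ) =
      1 / 2 * ((Module.finrank ℂ N : ℂ) + ε * LinearMap.trace ℂ V W) := by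
  have hsum : LinearMap.trace ℂ V W = LinearMap.trace ℂ N (W.restrict hN) := by
    -- In the decomposition `O × N` the operator is block diagonal, so its trace is the sum of the
    -- traces on the blocks.
    have hconj : (Submodule.prodEquivOfIsCompl O N h).conj
        ((W.restrict hO).prodMap (W.restrict hN)) = W := by
      ext x
      obtain ⟨⟨y, z⟩, rfl⟩ := (Submodule.prodEquivOfIsCompl O N h).surjective x
      rw [LinearEquiv.conj_apply_apply, LinearEquiv.symm_apply_apply]
      simp
    have h1 := LinearMap.trace_conj' ((W.restrict hO).prodMap (W.restrict hN))
      (Submodule.prodEquivOfIsCompl O N h)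
    rwa [hconj, LinearMap.trace_prodMap', htr, zero_add] at h1
  set E := Module.End.eigenspace (W.restrict hN) ε with hE
  have hmap : E.map N.subtype = N ⊓ Module.End.eigenspace W ε := by
    ext x
    simp only [Submodule.mem_map, Submodule.mem_inf, hE, Module.End.mem_eigenspace_iff,
      Submodule.subtype_apply]
    constructor
    · rintro ⟨y, hy, rfl⟩
      exact ⟨y.2, congrArg Subtype.val hy⟩
    · rintro ⟨hx, hx'⟩
      exact ⟨⟨x, hx⟩, Subtype.ext hx', rfl⟩
  -- The eigenspace dimension is read off as the trace of this projection; that it is one uses only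
  -- `W² = 1` and `ε² = 1`.
  have hproj : LinearMap.IsProj E ((1 / 2 : ℂ) • (LinearMap.id + ε • W.restrict hN)) := by
    constructor
    · intro x
      rw [hE, Module.End.mem_eigenspace_iff]
      have hx : W.restrict hN (W.restrict hN x) = x := Subtype.ext (hW x)
      simp only [LinearMap.smul_apply, LinearMap.add_apply, LinearMap.id_apply, map_smul, map_add,
        hx, smul_add, smul_smul]
      rw [add_comm]
      congr 2
      · ring
      · linear_combination (-1 / 2 : ℂ) * hε
    · intro x hx
      rw [hE, Module.End.mem_eigenspace_iff] at hx
      simp only [LinearMap.smul_apply, LinearMap.add_apply, LinearMap.id_apply, hx, smul_smul, hε,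
        one_smul, ← two_smul ℂ x]
      norm_num
  rw [← hmap, ← (Submodule.equivMapOfInjective _ N.injective_subtype E).finrank_eq,
    ← hproj.trace, hsum]
  simp [mul_add]

/-- An endomorphism that anticommutes with an automorphism has trace zero. -/
theorem LinearMap.trace_eq_zero_of_anticomm {V : Type*} [AddCommGroup V] [Module ℂ V]
    (W : Module.End ℂ V) (J : V ≃ₗ[ℂ] V) (hJ : ∀ x, J (W x) = -W (J x)) :
    LinearMap.trace ℂ V W = 0 := by
  have hconj : J.conj W = -W := by
    ext x
    rw [LinearEquiv.conj_apply_apply, hJ, LinearEquiv.apply_symm_apply, LinearMap.neg_apply]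
  have h := LinearMap.trace_conj' W J
  rw [hconj, map_neg] at h
  linear_combination (-1 / 2 : ℂ) * h

/-! ### Finite dimensionality of spaces of cusp forms. -/

noncomputable section

lemma UpperHalfPlane.periodic_comp_ofComplex {f : ℍ → ℂ} {h : ℝ} (hf : ∀ z, f (h +ᵥ z) = f z) :
    Function.Periodic (f ∘ ofComplex) h := by
  intro w
  by_cases! hw : 0 < w.im
  · have : 0 < (w + h).im := by simp [hw]
    simp only [Function.comp_apply, ofComplex_apply_of_im_pos this, ofComplex_apply_of_im_pos hw]
    convert! hf ⟨w, hw⟩ using 2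
    ext
    simp [add_comm]
  -- Off the upper half-plane `ofComplex` is constant, so the junk values are periodic too.
  · have : (w + h).im ≤ 0 := by simpa using hw
    simp [ofComplex_apply_of_im_nonpos this, ofComplex_apply_of_im_nonpos hw]

lemma ModularForm.slash_T_apply (f : ℍ → ℂ) (k : ℤ) (z : ℍ) :
    (f ∣[k] (Matrix.SpecialLinearGroup.mapGL ℝ ModularGroup.T)) z = f ((1 : ℝ) +ᵥ z) := by
  have h := ModularForm.SL_slash_apply (k := k) (f := f) ModularGroup.T z
  rw [ModularForm.SL_slash] at h
  rw [← UpperHalfPlane.modular_T_smul]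
  refine h.trans ?_
  simp [denom, ModularGroup.coe_T]

open SlashInvariantForm Manifold in
/-- The order of vanishing at `∞` of the norm of `f` is at least that of `f`. -/
theorem ModularForm.order_qExpansion_le_norm {𝒢 : Subgroup (GL (Fin 2) ℝ)} [𝒢.IsArithmetic]
    {F : Type*} [FunLike F ℍ ℂ] {k : ℤ} [ModularFormClass F 𝒢 k] (f : F)
    (hT : Matrix.SpecialLinearGroup.mapGL ℝ ModularGroup.T ∈ 𝒢) :
    (qExpansion 1 f).order ≤ (qExpansion 1 (ModularForm.norm 𝒮ℒ f)).order := by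
  classical
  let := Fintype.ofFinite (𝒮ℒ ⧸ 𝒢.subgroupOf 𝒮ℒ)
  let q₀ : 𝒮ℒ ⧸ 𝒢.subgroupOf 𝒮ℒ := ((1 : 𝒮ℒ) : 𝒮ℒ ⧸ 𝒢.subgroupOf 𝒮ℒ)
  let G : ℍ → ℂ := ∏ q ∈ Finset.univ.erase q₀, quotientFunc f q
  have h₀ : quotientFunc f q₀ = f := by
    change (f : ℍ → ℂ) ∣[k] ((1 : 𝒮ℒ) : GL (Fin 2) ℝ)⁻¹ = f
    simp
  -- `f` is the factor of the norm at the trivial coset. The cofactor `G` need not be modular for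
  -- `𝒢`: being 1-periodic, holomorphic and bounded at `∞` gives it a power series in `q`, and
  -- orders add.
  have hnorm : ⇑(ModularForm.norm 𝒮ℒ f) = f * G := by
    rw [ModularForm.coe_norm, ← Finset.mul_prod_erase _ _ (Finset.mem_univ q₀), h₀]
  have hT' : Matrix.SpecialLinearGroup.mapGL ℝ ModularGroup.T ∈ 𝒮ℒ := ⟨_, rfl⟩
  let t : 𝒮ℒ := ⟨_, hT'⟩
  -- Since `T ∈ 𝒢`, translation by 1 fixes the trivial coset and so permutes the other factors,
  -- whence `G` is periodic.
  have ht₀ : t⁻¹ • q₀ = q₀ := by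
    change ((t⁻¹ * 1 : 𝒮ℒ) : 𝒮ℒ ⧸ 𝒢.subgroupOf 𝒮ℒ) = _
    rw [mul_one, QuotientGroup.eq]
    simpa [Subgroup.mem_subgroupOf] using hT
  have hGper : ∀ z, G ((1 : ℝ) +ᵥ z) = G z := by
    intro z
    simp only [G, Finset.prod_apply]
    refine Finset.prod_equiv (MulAction.toPerm t⁻¹) (fun q => ?_) (fun q _ => ?_)
    · simp only [Finset.mem_erase, Finset.mem_univ, and_true, MulAction.toPerm_apply]
      rw [not_iff_not]
      conv_rhs => rw [← ht₀]
      exact (smul_left_cancel_iff _).symm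
    · rw [← ModularForm.slash_T_apply (quotientFunc f q) k, quotientFunc_smul f hT']
      rfl
  have hGhol : MDiff G := .prod (Quotient.forall.mpr fun ⟨r, hr⟩ _ ↦ (translate f r⁻¹).holo')
  have hGbdd : IsBoundedAtImInfty G := by
    have hG : G = fun z => ∏ q ∈ Finset.univ.erase q₀, quotientFunc f q z := Finset.prod_fn _ _
    rw [IsBoundedAtImInfty, Filter.BoundedAtFilter, hG,
      show (1 : ℍ → ℝ) = (fun x ↦ ∏ q ∈ Finset.univ.erase q₀, 1) by ext; simp]
    refine .finsetProd (Quotient.forall.mpr fun ⟨r, hr⟩ _ ↦ ?_)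
    have hc : IsCusp OnePoint.infty 𝒮ℒ := Fact.out
    have := (translate f r⁻¹).bdd_at_cusps' (c := OnePoint.infty)
      (by simpa using hc.of_isFiniteRelIndex_conj hr) 1 (by simp)
    rwa [SlashAction.slash_one] at this
  have h1 : (1 : ℝ) ∈ 𝒢.strictPeriods := by
    rw [Subgroup.mem_strictPeriods_iff]
    convert! hT
    ext i j
    fin_cases i <;> fin_cases j <;> simp [ModularGroup.coe_T]
  rw [hnorm, qExpansion_mul (ModularFormClass.analyticAt_cuspFunction_zero f one_pos h1)
    (analyticAt_cuspFunction_zero one_pos (periodic_comp_ofComplex hGper) hGhol hGbdd),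
    PowerSeries.order_mul]
  exact le_add_of_nonneg_right zero_le

namespace AtkinLehner

lemma mapGL_T_mem_Gamma0GL (M : ℕ) :
    Matrix.SpecialLinearGroup.mapGL ℝ ModularGroup.T ∈ Gamma0GL M :=
  ⟨ModularGroup.T, Gamma0_mem.mpr (by simp [ModularGroup.coe_T]), rfl⟩

/-- The truncated `q`-expansion, as a linear map. -/
def qCoeffs (M : ℕ) (k : ℤ) (n : ℕ) : CuspSpace M k →ₗ[ℂ] (Fin n → ℂ) where
  toFun f i := (qExpansion 1 f).coeff i
  map_add' f g := by
    ext i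
    rw [FunLike.coe_add, ModularForm.qExpansion_add (Γ := Gamma0GL M) (a := k) (b := k) one_pos
      (by simp) f g]
    simp
  map_smul' a f := by
    ext i
    rw [FunLike.coe_smul, ModularForm.qExpansion_smul (Γ := Gamma0GL M) (k := k) one_pos
      (by simp) a f]
    simp

/-- If the first `n + 1` coefficients of `f` vanish, its level-one norm, of weight `k` times the
index, vanishes beyond the Sturm bound. The norm is then zero, hence so is `f`. -/
instance finiteDimensional_cuspSpace (M : ℕ) [NeZero M] (k : ℤ) :
    FiniteDimensional ℂ (CuspSpace M k) := by
  let n := (k * Nat.card (𝒮ℒ ⧸ (Gamma0GL M).subgroupOf 𝒮ℒ)).toNat / 12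
  refine FiniteDimensional.of_injective (qCoeffs M k (n + 1))
    ((injective_iff_map_eq_zero _).mpr fun f hf => ?_)
  have hord : (n : ℕ∞) < (qExpansion 1 f).order := by
    refine (Nat.cast_lt.mpr n.lt_succ_self).trans_le (PowerSeries.le_order _ _ fun i hi => ?_)
    exact congrFun hf ⟨i, by exact_mod_cast hi⟩
  have hnorm := ModularForm.sturm_bound_levelOne
    (hord.trans_le (ModularForm.order_qExpansion_le_norm f (mapGL_T_mem_Gamma0GL M)))
  rw [ModularForm.norm_eq_zero_iff] at hnorm
  exact DFunLike.coe_injective hnorm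

end AtkinLehner
end

/-! ### Action of the Atkin–Lehner operator on the old subspace. -/

noncomputable section

lemma UpperHalfPlane.σ_of_det_pos {g : GL (Fin 2) ℝ} (hg : 0 < g.det.val) (w : ℂ) :
    σ g w = w := by
  unfold UpperHalfPlane.σ
  rw [if_pos hg]
  rfl

lemma ModularForm.smul_slash_of_det_pos (k : ℤ) {g : GL (Fin 2) ℝ} (hg : 0 < g.det.val)
    (f : ℍ → ℂ) (c : ℂ) : (c • f) ∣[k] g = c • (f ∣[k] g) := by
  rw [ModularForm.smul_slash, σ_of_det_pos hg]

lemma ModularForm.slash_scalar (k : ℤ) (u : ℝˣ) (hu : 0 < u.val) (f : ℍ → ℂ) :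
    f ∣[k] (Matrix.GeneralLinearGroup.scalar (Fin 2) u) = (u.val : ℂ) ^ (k - 2) • f := by
  have hu0 : (u.val : ℂ) ≠ 0 := by exact_mod_cast hu.ne'
  have hdet : (Matrix.GeneralLinearGroup.scalar (Fin 2) u).det.val = u.val ^ 2 := by
    rw [Matrix.GeneralLinearGroup.det_scalar]
    simp
  have hpos : 0 < (Matrix.GeneralLinearGroup.scalar (Fin 2) u).det.val := by
    rw [hdet]
    positivity
  ext z
  have hz : Matrix.GeneralLinearGroup.scalar (Fin 2) u • z = z := by
    ext1
    rw [coe_smul_of_det_pos hpos]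
    simp [num, denom, hu0]
  have hd : denom (Matrix.GeneralLinearGroup.scalar (Fin 2) u) z = u.val := by
    simp [denom]
  rw [ModularForm.slash_apply, σ_of_det_pos hpos, hz, hd, hdet, abs_of_pos (by positivity),
    Pi.smul_apply, smul_eq_mul, Complex.ofReal_pow, mul_assoc, mul_comm, ← zpow_natCast,
    ← zpow_mul, ← zpow_add₀ hu0]
  congr 2
  push_cast
  ring

namespace AtkinLehner

lemma exists_mem_Gamma0GL {M : ℕ} {a b c d : ℤ} (h : a * d - b * (M * c) = 1) :
    ∃ γ ∈ Gamma0GL M, γ.val = !![(a : ℝ), b; (M : ℝ) * c, d] := by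
  have h' : (a * d - b * (M * c) : ℝ) = 1 := by exact_mod_cast h
  let γ := Matrix.GeneralLinearGroup.mkOfDetNeZero !![(a : ℝ), b; (M : ℝ) * c, d]
    (by rw [Matrix.det_fin_two_of, h']; exact one_ne_zero)
  exact ⟨γ, mem_Gamma0GL_iff.mpr ⟨a, b, c, d, h, rfl⟩, rfl⟩

lemma coe_oldIncl (p N : ℕ) (k : ℤ) (f : CuspSpace N k) : ⇑(oldIncl p N k f) = ⇑f := by
  ext z
  simp

variable (p N : ℕ) [Fact p.Prime] (hpN : p.Coprime N)

/-- The prime `p` as a unit of `ℝ`. -/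
def primeUnit : ℝˣ := Units.mk0 p (by exact_mod_cast (Fact.out : p.Prime).ne_zero)

lemma primeUnit_pos : 0 < (primeUnit p).val := by
  change (0 : ℝ) < p
  exact_mod_cast (Fact.out : p.Prime).pos

lemma alMatrix_det_pos : 0 < (alMatrix p N hpN).det.val := by
  rw [alMatrix_det]
  exact_mod_cast (Fact.out : p.Prime).pos

lemma alMatrix_val : (alMatrix p N hpN).val =
    !![(p : ℝ) * (p.gcdA N : ℝ), -(p.gcdB N : ℝ); (p : ℝ) * N, p] := rfl

lemma diagMatrix_val : (diagMatrix p).val = !![(p : ℝ), 0; 0, 1] := rfl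

lemma scalar_primeUnit_val : (Matrix.GeneralLinearGroup.scalar (Fin 2) (primeUnit p)).val =
    !![(p : ℝ), 0; 0, p] := by
  ext i j
  fin_cases i <;> fin_cases j <;> simp [primeUnit, Matrix.natCast_apply]

/-- Matrix form of `W² = 1`: the scalar `p` is cancelled by the normalising power of `p`, and `γ`
acts trivially on forms. The entries of `γ` are those of the squared matrix divided by `p`. -/
lemma alMatrix_mul_self : ∃ γ ∈ Gamma0GL (p * N), alMatrix p N hpN * alMatrix p N hpN =
    Matrix.GeneralLinearGroup.scalar (Fin 2) (primeUnit p) * γ := by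
  have h := bezout_eq hpN
  set x := p.gcdA N with hx
  set y := p.gcdB N with hy
  obtain ⟨γ, hγ, hγ'⟩ := exists_mem_Gamma0GL (M := p * N) (a := p * x ^ 2 - N * y)
    (b := -(x * y) - y) (c := x + 1) (d := p - N * y) (by
      push_cast
      linear_combination (p * x + N * y + 1) * h)
  refine ⟨γ, hγ, Units.ext ?_⟩
  rw [Units.val_mul, Units.val_mul, hγ', alMatrix_val, scalar_primeUnit_val, ← hx, ← hy]
  ext i j
  fin_cases i <;> fin_cases j <;>
    simp [Matrix.mul_apply, Fin.sum_univ_two] <;> ring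

/-- A form of level `N` absorbs `γ`, so on such forms `W` agrees with `z ↦ pz` up to a scalar. -/
lemma alMatrix_eq_mul_diagMatrix :
    ∃ γ ∈ Gamma0GL N, alMatrix p N hpN = γ * diagMatrix p := by
  obtain ⟨γ, hγ, hγ'⟩ := exists_mem_Gamma0GL (M := N) (a := p.gcdA N)
    (b := -p.gcdB N) (c := 1) (d := p) (by linear_combination bezout_eq hpN)
  refine ⟨γ, hγ, Units.ext ?_⟩
  rw [Units.val_mul, hγ', alMatrix_val, diagMatrix_val]
  ext i j
  fin_cases i <;> fin_cases j <;> simp [Matrix.mul_apply, Fin.sum_univ_two] <;> ring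

variable (k : ℤ)

lemma coe_atkinLehner (f : CuspSpace (p * N) k) :
    ⇑(atkinLehner p N hpN k f) = (p : ℂ) ^ (1 - k / 2) • (⇑f ∣[k] alMatrix p N hpN) := rfl

lemma coe_oldScale (f : CuspSpace N k) :
    ⇑(oldScale p N k f) = (p : ℂ) ^ (1 - k) • (⇑f ∣[k] diagMatrix p) := rfl

lemma prime_cast_ne_zero : (p : ℂ) ≠ 0 := by exact_mod_cast (Fact.out : p.Prime).ne_zero

variable {k}

lemma atkinLehner_atkinLehner (hk : Even k) (f : CuspSpace (p * N) k) :
    atkinLehner p N hpN k (atkinLehner p N hpN k f) = f := by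
  obtain ⟨γ, hγ, h⟩ := alMatrix_mul_self p N hpN
  refine DFunLike.coe_injective ?_
  rw [coe_atkinLehner, coe_atkinLehner,
    ModularForm.smul_slash_of_det_pos _ (alMatrix_det_pos p N hpN), ← SlashAction.slash_mul, h,
    SlashAction.slash_mul, ModularForm.slash_scalar _ _ (primeUnit_pos p),
    ModularForm.smul_slash_of_det_pos _ (by simp [Subgroup.HasDetOne.det_eq hγ]),
    SlashInvariantFormClass.slash_action_eq f γ hγ, smul_smul, smul_smul]
  have hp := prime_cast_ne_zero p
  have : (p : ℂ) ^ (1 - k / 2) * ((p : ℂ) ^ (1 - k / 2) * ((primeUnit p).val : ℂ) ^ (k - 2)) = 1 := by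
    change (p : ℂ) ^ (1 - k / 2) * ((p : ℂ) ^ (1 - k / 2) * (((p : ℝ) : ℂ)) ^ (k - 2)) = 1
    rw [Complex.ofReal_natCast, ← zpow_add₀ hp, ← zpow_add₀ hp]
    obtain ⟨m, rfl⟩ := hk
    rw [show 1 - (m + m) / 2 + (1 - (m + m) / 2 + (m + m - 2)) = 0 by omega, zpow_zero]
  rw [mul_assoc, this, one_smul]

lemma atkinLehner_oldIncl (hk : Even k) (f : CuspSpace N k) :
    atkinLehner p N hpN k (oldIncl p N k f) = (p : ℂ) ^ (k / 2) • oldScale p N k f := by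
  obtain ⟨γ, hγ, h⟩ := alMatrix_eq_mul_diagMatrix p N hpN
  refine DFunLike.coe_injective ?_
  rw [coe_atkinLehner, coe_oldIncl, FunLike.coe_smul, coe_oldScale, h, SlashAction.slash_mul,
    SlashInvariantFormClass.slash_action_eq f γ hγ, smul_smul, ← zpow_add₀ (prime_cast_ne_zero p)]
  congr 2
  obtain ⟨m, rfl⟩ := hk
  omega

/-- Obtained by applying the involution to the formula for `oldIncl`, with no further matrix
identity. -/
lemma atkinLehner_oldScale (hk : Even k) (f : CuspSpace N k) :
    atkinLehner p N hpN k (oldScale p N k f) = (p : ℂ) ^ (-(k / 2)) • oldIncl p N k f := by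
  have hp := prime_cast_ne_zero p
  have h := congrArg (atkinLehner p N hpN k) (atkinLehner_oldIncl p N hpN hk f)
  rw [atkinLehner_atkinLehner p N hpN hk, map_smul] at h
  rw [h, smul_smul, ← zpow_add₀ hp, neg_add_cancel, zpow_zero, one_smul]

lemma atkinLehner_mem_pOld (hk : Even k) {f : CuspSpace (p * N) k} (hf : f ∈ pOld p N k) :
    atkinLehner p N hpN k f ∈ pOld p N k := by
  obtain ⟨_, ⟨g, rfl⟩, _, ⟨h, rfl⟩, rfl⟩ := Submodule.mem_sup.mp hf
  rw [map_add, atkinLehner_oldIncl p N hpN hk, atkinLehner_oldScale p N hpN hk]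
  exact add_mem (Submodule.smul_mem _ _ (Submodule.mem_sup_right ⟨g, rfl⟩))
    (Submodule.smul_mem _ _ (Submodule.mem_sup_left ⟨h, rfl⟩))

end AtkinLehner
end

/-! ### Independence of the two degeneracy maps and the trace on old forms. -/

noncomputable section

namespace AtkinLehner

/-- A cusp form which is proportional to its rescaling by some `c > 1` vanishes. -/
lemma eq_zero_of_eq_mul_smul {M : ℕ} [NeZero M] {k : ℤ} (f : CuspSpace M k) (a : ℂ)
    {c : {x : ℝ // 0 < x}} (hc : 1 < c.val) (h : ∀ z : ℍ, f z = a * f (c • z)) : f = 0 := by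
  -- With `‖a‖ < c ^ m`, the weight `y ^ m` outgrows the factor `a` at each rescaling, while
  -- exponential decay of `f` still forces `y ^ m * ‖f‖ → 0` at `∞`.
  obtain ⟨m, hm⟩ := pow_unbounded_of_one_lt ‖a‖ hc
  have hlim : Filter.Tendsto (fun τ : ℍ => τ.im ^ m * ‖f τ‖) atImInfty (nhds 0) := by
    obtain ⟨b, hb, hO⟩ := CuspFormClass.exp_decay_atImInfty' (Γ := Gamma0GL M) (k := k) f
    have h1 : (fun τ : ℍ => τ.im ^ m) =o[atImInfty] fun τ => Real.exp (b * τ.im) :=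
      (isLittleO_pow_exp_pos_mul_atTop m hb).comp_tendsto Filter.tendsto_comap
    have h2 := h1.mul_isBigO hO.norm_left
    refine Asymptotics.isLittleO_one_iff ℝ |>.mp (h2.congr_right fun τ => ?_)
    rw [← Real.exp_add]
    simp
  have hiter : ∀ (n : ℕ) (z : ℍ), f z = a ^ n * f (c ^ n • z) := by
    intro n
    induction n with
    | zero => simp
    | succ n ih =>
      intro z
      rw [ih, h (c ^ n • z), smul_smul, ← pow_succ', pow_succ]
      ring
  have him : ∀ (n : ℕ) (z : ℍ), (c ^ n • z).im = c.val ^ n * z.im := fun n z => by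
    simp
  refine DFunLike.ext _ _ fun z => ?_
  have htend : Filter.Tendsto (fun n : ℕ => c ^ n • z) Filter.atTop atImInfty := by
    rw [atImInfty, Filter.tendsto_comap_iff]
    have := (tendsto_pow_atTop_atTop_of_one_lt hc).atTop_mul_const z.im_pos
    exact this.congr fun n => (him n z).symm
  -- Along `z, cz, c²z, …` the quantity `y ^ m * ‖f‖` never falls below its initial value, yet it
  -- tends to zero.
  have hbound : ∀ n : ℕ, z.im ^ m * ‖f z‖ ≤ (c ^ n • z).im ^ m * ‖f (c ^ n • z)‖ := by
    intro n
    have hc0 : 0 < c.val := c.2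
    rw [hiter n z, norm_mul, norm_pow, him, mul_pow, ← pow_mul, mul_comm n m, pow_mul]
    have := pow_le_pow_left₀ (norm_nonneg a) hm.le n
    have h3 : 0 ≤ z.im ^ m := pow_nonneg z.im_pos.le m
    calc z.im ^ m * (‖a‖ ^ n * ‖f (c ^ n • z)‖)
        ≤ z.im ^ m * ((c.val ^ m) ^ n * ‖f (c ^ n • z)‖) := by gcongr
      _ = _ := by ring
  have hle := ge_of_tendsto' (hlim.comp htend) hbound
  have h0 : ‖f z‖ ≤ 0 := nonpos_of_mul_nonpos_right hle (pow_pos z.im_pos m)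
  simpa using h0

variable (p N : ℕ) [Fact p.Prime] [NeZero N] (hpN : p.Coprime N) {k : ℤ}

-- Applying `W` to `f(z) = g(pz)` yields `g(z) = p ^ k f(pz)`. Together they give `f(z) = p ^ k
-- f(p²z)`, which the decay at `∞` forbids unless `f = 0`.
include hpN in
lemma eq_zero_of_oldIncl_eq_oldScale (hk : Even k) {f g : CuspSpace N k}
    (h : oldIncl p N k f = oldScale p N k g) : f = 0 ∧ g = 0 := by
  have hp := prime_cast_ne_zero p
  have hp0 : (0 : ℝ) < p := by exact_mod_cast (Fact.out : p.Prime).pos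
  let c : {x : ℝ // 0 < x} := ⟨p, hp0⟩
  have h1 : ∀ z : ℍ, f z = g (c • z) := fun z => by
    have := DFunLike.congr_fun h z
    rwa [oldIncl_apply, oldScale_apply] at this
  have h2 : ∀ z : ℍ, g z = (p : ℂ) ^ k * f (c • z) := fun z => by
    have h3 := DFunLike.congr_fun (congrArg (atkinLehner p N hpN k) h) z
    rw [atkinLehner_oldIncl p N hpN hk, atkinLehner_oldScale p N hpN hk, FunLike.coe_smul,
      FunLike.coe_smul, Pi.smul_apply, Pi.smul_apply, oldIncl_apply, oldScale_apply, smul_eq_mul,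
      smul_eq_mul] at h3
    have h4 : (p : ℂ) ^ k = (p : ℂ) ^ (k / 2) * (p : ℂ) ^ (k / 2) := by
      rw [← zpow_add₀ hp]
      congr 1
      obtain ⟨m, rfl⟩ := hk
      omega
    have h5 : (p : ℂ) ^ (k / 2) * (p : ℂ) ^ (-(k / 2)) = 1 := by
      rw [← zpow_add₀ hp, add_neg_cancel, zpow_zero]
    rw [h4, mul_assoc]
    change _ = _ * (_ * f (c • z))
    rw [h3, ← mul_assoc, h5, one_mul]
  have hc : 1 < (c * c).val := by
    have : (1 : ℝ) < p := by exact_mod_cast (Fact.out : p.Prime).one_lt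
    exact one_lt_mul_of_lt_of_le this this.le
  have hf : f = 0 := eq_zero_of_eq_mul_smul f ((p : ℂ) ^ k) hc fun z => by
    rw [h1, h2, smul_smul]
  refine ⟨hf, DFunLike.ext _ _ fun z => ?_⟩
  rw [h2, hf]
  simp

include hpN in
lemma old_coprod_injective (hk : Even k) :
    Function.Injective ((oldIncl p N k).coprod (oldScale p N k)) := by
  refine (injective_iff_map_eq_zero _).mpr fun ⟨f, g⟩ h => ?_
  rw [LinearMap.coprod_apply, add_eq_zero_iff_eq_neg, ← map_neg] at h
  obtain ⟨h1, h2⟩ := eq_zero_of_oldIncl_eq_oldScale p N hpN hk h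
  rw [Prod.mk_eq_zero]
  exact ⟨h1, neg_eq_zero.mp h2⟩

/-- `(f, g) ↦ f(z) + g(pz)` as an isomorphism onto the `p`-old subspace. -/
def oldEquiv (hk : Even k) : (CuspSpace N k × CuspSpace N k) ≃ₗ[ℂ] pOld p N k :=
  (LinearEquiv.ofInjective _ (old_coprod_injective p N hpN hk)).trans
    (LinearEquiv.ofEq _ _ (LinearMap.range_coprod _ _))

lemma coe_oldEquiv (hk : Even k) (f g : CuspSpace N k) :
    (oldEquiv p N hpN hk (f, g) : CuspSpace (p * N) k) = oldIncl p N k f + oldScale p N k g := rfl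

/-- In the coordinates of `oldEquiv`, `W` swaps the two factors up to scalars, so it anticommutes
with `(f, g) ↦ (f, -g)`. -/
lemma trace_atkinLehner_pOld (hk : Even k) :
    LinearMap.trace ℂ (pOld p N k) ((atkinLehner p N hpN k).restrict
      fun _ => atkinLehner_mem_pOld p N hpN hk) = 0 := by
  let e := oldEquiv p N hpN hk
  let W := (atkinLehner p N hpN k).restrict fun _ => atkinLehner_mem_pOld p N hpN hk
  have hW : ∀ f g, W (e (f, g)) = e ((p : ℂ) ^ (-(k / 2)) • g, (p : ℂ) ^ (k / 2) • f) := by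
    intro f g
    refine Subtype.ext ?_
    rw [coe_oldEquiv, LinearMap.coe_restrict_apply, coe_oldEquiv, map_add,
      atkinLehner_oldIncl p N hpN hk, atkinLehner_oldScale p N hpN hk, map_smul, map_smul, add_comm]
  let J₀ := (LinearEquiv.refl ℂ (CuspSpace N k)).prodCongr (LinearEquiv.neg ℂ (M := CuspSpace N k))
  have hJ₀ : ∀ f g, J₀ (f, g) = (f, -g) := fun f g => by simp [J₀]
  refine LinearMap.trace_eq_zero_of_anticomm W (e.symm ≪≫ₗ J₀ ≪≫ₗ e) fun x => ?_
  obtain ⟨⟨f, g⟩, rfl⟩ := e.surjective x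
  simp only [hW, LinearEquiv.trans_apply, LinearEquiv.symm_apply_apply, hJ₀]
  rw [← map_neg]
  simp

end AtkinLehner
end

/-! ### Fundamental domains for finite-index subgroups of `SL(2, ℤ)`. -/

noncomputable section

open scoped Pointwise

lemma Complex.volume_re_eq (c : ℝ) : volume {z : ℂ | z.re = c} = 0 := by
  have h := Complex.volume_preserving_equiv_real_prod.measure_preimage_equiv ({c} ×ˢ Set.univ)
  have hs : {z : ℂ | z.re = c} = Complex.measurableEquivRealProd ⁻¹' ({c} ×ˢ Set.univ) := by
    ext z
    simp [Complex.measurableEquivRealProd_apply]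
  rw [hs, h, Measure.volume_eq_prod, Measure.prod_prod]
  simp

namespace ModularGroup

/-- The boundary of the standard fundamental domain has measure zero. -/
lemma volume_fd_diff_fdo : (volume : Measure ℍ) (𝒟 \ 𝒟ᵒ) = 0 := by
  rw [volume_eq_lintegral]
  refine setLIntegral_measure_zero _ _ (measure_mono_null (t := Metric.sphere 0 1 ∪
    ({z : ℂ | z.re = 1 / 2} ∪ {z : ℂ | z.re = -(1 / 2)})) ?_ ?_)
  · rintro _ ⟨z, ⟨⟨h1, h2⟩, h3⟩, rfl⟩
    by_contra hcon
    simp only [Set.mem_union, not_or, mem_sphere_zero_iff_norm, Set.mem_ofPred_eq] at hcon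
    obtain ⟨h4, h5, h6⟩ := hcon
    refine h3 ⟨lt_of_le_of_ne h1 fun h => h4 ?_, lt_of_le_of_ne h2 fun h => ?_⟩
    · rw [Complex.normSq_eq_norm_sq] at h
      nlinarith [norm_nonneg (z : ℂ)]
    · rcases (abs_eq (by norm_num)).mp h with h | h
      · exact h5 h
      · exact h6 h
  · refine measure_union_null (Measure.addHaar_sphere _ _ _) (measure_union_null ?_ ?_) <;>
    exact Complex.volume_re_eq _

lemma measurableSet_fd : MeasurableSet 𝒟 := isClosed_fd.measurableSet

instance : SMulInvariantMeasure SL(2, ℤ) ℍ volume where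
  measure_preimage_smul g _ hs :=
    SMulInvariantMeasure.measure_preimage_smul (Matrix.SpecialLinearGroup.mapGL ℝ g) hs

instance : MeasurableConstSMul SL(2, ℤ) ℍ where
  measurable_const_smul g := measurable_const_smul (Matrix.SpecialLinearGroup.mapGL ℝ g)

instance : Countable SL(2, ℤ) :=
  Function.Injective.countable (β := Fin 2 → Fin 2 → ℤ) Subtype.val_injective

/-- Translates of the standard fundamental domain by matrices other than `± 1` overlap with it in
a set of measure zero. -/
lemma aedisjoint_smul_fd {g : SL(2, ℤ)} (hg : g ≠ 1) (hg' : g ≠ -1) :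
    AEDisjoint volume (g • 𝒟) (𝒟 : Set ℍ) := by
  refine measure_mono_null (t := 𝒟 \ 𝒟ᵒ) ?_ volume_fd_diff_fdo
  rintro z ⟨hz, hz'⟩
  refine ⟨hz', fun hz'' => ?_⟩
  rw [Set.mem_smul_set_iff_inv_smul_mem] at hz
  rcases eq_one_or_neg_one_of_mem_fdo_mem_fd hz'' hz with h | h
  · exact hg (inv_eq_one.mp h)
  · exact hg' (by rw [← inv_inv g, h, inv_neg, inv_one])

/-- The image of `Γ` in the group of permutations of `ℍ`. -/
abbrev permSubgroup (Γ : Subgroup SL(2, ℤ)) : Subgroup (Equiv.Perm ℍ) :=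
  Γ.map (MulAction.toPermHom SL(2, ℤ) ℍ)

variable (Γ : Subgroup SL(2, ℤ))

lemma exists_permSubgroup_smul (g : permSubgroup Γ) :
    ∃ γ ∈ Γ, ∀ z : ℍ, g • z = γ • z := by
  obtain ⟨_, γ, hγ, rfl⟩ := g
  exact ⟨γ, hγ, fun z => rfl⟩

instance : MeasurableConstSMul (permSubgroup Γ) ℍ where
  measurable_const_smul g := by
    obtain ⟨γ, -, h⟩ := exists_permSubgroup_smul Γ g
    simpa only [h] using measurable_const_smul γ

instance : SMulInvariantMeasure (permSubgroup Γ) ℍ volume where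
  measure_preimage_smul g s hs := by
    obtain ⟨γ, -, h⟩ := exists_permSubgroup_smul Γ g
    simpa only [h] using SMulInvariantMeasure.measure_preimage_smul γ hs

instance : Countable (permSubgroup Γ) := by
  refine Set.countable_coe_iff.mpr (Set.Countable.image ?_ _)
  exact Set.to_countable _

/-- The union of the translates of the standard fundamental domain by (inverses of)
representatives of `SL(2, ℤ) / Γ`. -/
def subgroupFd : Set ℍ := ⋃ q : SL(2, ℤ) ⧸ Γ, q.out⁻¹ • 𝒟

variable {Γ}

lemma measurableSet_out_smul_fd (q : SL(2, ℤ) ⧸ Γ) : MeasurableSet (q.out⁻¹ • 𝒟 : Set ℍ) :=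
  measurableSet_fd.const_smul _

lemma aedisjoint_smul_smul_fd {g h : SL(2, ℤ)} (hg : g⁻¹ * h ≠ 1) (hg' : g⁻¹ * h ≠ -1) :
    AEDisjoint volume (g • 𝒟) (h • 𝒟 : Set ℍ) := by
  have h1 := aedisjoint_smul_fd hg hg'
  rw [AEDisjoint, ← measure_smul volume g, Set.smul_set_inter, smul_smul, mul_inv_cancel_left] at h1
  rw [AEDisjoint, Set.inter_comm, h1]

/-- The group is taken inside the permutations of `ℍ` because `-1` acts trivially, so `Γ` itself
could not have almost disjoint translates. -/
lemma isFundamentalDomain_subgroupFd [Finite (SL(2, ℤ) ⧸ Γ)] (hΓ : -1 ∈ Γ) :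
    IsFundamentalDomain (permSubgroup Γ) (subgroupFd Γ) := by
  refine IsFundamentalDomain.mk'' ?_ (ae_of_all _ fun z => ?_) (fun g hg => ?_)
    (fun g => (measurePreserving_smul g volume).quasiMeasurePreserving)
  · exact (MeasurableSet.iUnion measurableSet_out_smul_fd).nullMeasurableSet
  · obtain ⟨g, hg⟩ := exists_smul_mem_fd z
    obtain ⟨γ, hγ⟩ := QuotientGroup.mk_out_eq_mul Γ g
    refine ⟨⟨_, γ⁻¹, inv_mem γ.2, rfl⟩, Set.mem_iUnion.mpr ⟨(g : SL(2, ℤ) ⧸ Γ), ?_⟩⟩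
    change (γ : SL(2, ℤ))⁻¹ • z ∈ _
    rw [Set.mem_smul_set_iff_inv_smul_mem, inv_inv, hγ, smul_smul, mul_inv_cancel_right]
    exact hg
  · obtain ⟨_, γ, hγ, rfl⟩ := g
    change AEDisjoint volume (γ • subgroupFd Γ) (subgroupFd Γ)
    rw [subgroupFd, Set.smul_set_iUnion, AEDisjoint.iUnion_left_iff]
    intro q
    rw [AEDisjoint.iUnion_right_iff]
    intro q'
    rw [smul_smul]
    -- Two tiles overlap substantially only if their matrices differ by `ε = ±1`. Then the cosets
    -- coincide and `εγ = 1`, so `γ` acts trivially, against `hg`.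
    have key : ∀ ε : SL(2, ℤ), ε ∈ Γ → (∀ x, ε * x = x * ε) → (∀ z : ℍ, ε • z = z) →
        (γ * q.out⁻¹)⁻¹ * q'.out⁻¹ ≠ ε := by
      intro ε hε hcomm hsmul h
      have h1 : q.out = q'.out * (ε * γ) := by
        have : (γ * q.out⁻¹)⁻¹ * q'.out⁻¹ = q.out * γ⁻¹ * q'.out⁻¹ := by group
        rw [this] at h
        have h2 : q.out = ε * q'.out * γ := by
          rw [← h]
          group
        rw [h2, hcomm, mul_assoc]
      have hq : q = q' := by
        rw [← q.out_eq', ← q'.out_eq']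
        refine (Quotient.eq''.mpr ?_)
        rw [QuotientGroup.leftRel_apply, h1]
        have : (q'.out * (ε * γ))⁻¹ * q'.out = (ε * γ)⁻¹ := by group
        rw [this]
        exact inv_mem (mul_mem hε hγ)
      subst hq
      have h3 : ε * γ = 1 := by simpa using h1.symm
      refine hg (Subtype.ext (Equiv.ext fun z => ?_))
      change γ • z = z
      rw [← hsmul (γ • z), smul_smul, h3, one_smul]
    refine aedisjoint_smul_smul_fd (key 1 (one_mem _) (by simp) (by simp)) (key (-1) hΓ (by simp) ?_)
    intro z
    rw [SL_neg_smul, one_smul]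

lemma aedisjoint_out_smul_fd (hΓ : -1 ∈ Γ) :
    Pairwise (fun q q' : SL(2, ℤ) ⧸ Γ =>
      AEDisjoint volume (q.out⁻¹ • 𝒟 : Set ℍ) (q'.out⁻¹ • 𝒟)) := by
  intro q q' hqq
  have key : ∀ ε ∈ Γ, (∀ x, ε * x = x * ε) → (q.out⁻¹)⁻¹ * q'.out⁻¹ ≠ ε := by
    intro ε hε hcomm h
    refine hqq ?_
    have h1 : q.out = q'.out * ε := by
      rw [← hcomm, ← h]
      group
    rw [← q.out_eq', ← q'.out_eq']
    refine (Quotient.eq''.mpr ?_)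
    rw [QuotientGroup.leftRel_apply, h1]
    have : (q'.out * ε)⁻¹ * q'.out = ε⁻¹ := by group
    rw [this]
    exact inv_mem hε
  exact aedisjoint_smul_smul_fd (key 1 (one_mem _) (by simp)) (key (-1) hΓ (by simp))

lemma smul_fd_eq_image (g : SL(2, ℤ)) : g • 𝒟 = (fun z : ℍ => g • z) '' 𝒟 := rfl

lemma integrableOn_subgroupFd [Finite (SL(2, ℤ) ⧸ Γ)] {F : ℍ → ℂ}
    (hF : ∀ g : SL(2, ℤ), IntegrableOn (fun τ => F (g • τ)) 𝒟) :
    IntegrableOn F (subgroupFd Γ) := by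
  rw [subgroupFd, integrableOn_finite_iUnion]
  intro q
  rw [smul_fd_eq_image, (measurePreserving_smul q.out⁻¹ volume).integrableOn_image
    (measurableEmbedding_const_smul _)]
  exact hF _

/-- An integral over the fundamental domain of `Γ` is a sum of integrals over the standard
fundamental domain. -/
lemma setIntegral_subgroupFd [Fintype (SL(2, ℤ) ⧸ Γ)] (hΓ : -1 ∈ Γ) {F : ℍ → ℂ}
    (hF : ∀ g : SL(2, ℤ), IntegrableOn (fun τ => F (g • τ)) 𝒟) :
    ∫ τ in subgroupFd Γ, F τ = ∑ q : SL(2, ℤ) ⧸ Γ, ∫ τ in 𝒟, F (q.out⁻¹ • τ) := by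
  have hint := integrableOn_subgroupFd hF (Γ := Γ)
  rw [subgroupFd] at hint ⊢
  rw [integral_iUnion_ae (fun q => (measurableSet_out_smul_fd q).nullMeasurableSet)
    (aedisjoint_out_smul_fd hΓ) hint, tsum_fintype]
  refine Finset.sum_congr rfl fun q _ => ?_
  rw [smul_fd_eq_image, (measurePreserving_smul q.out⁻¹ volume).setIntegral_image_emb
    (measurableEmbedding_const_smul _)]

end ModularGroup
end

/-! ### The Petersson product as an inner product, and its invariance under `W`. -/

noncomputable section

open scoped ComplexConjugate
open ModularGroup

/-- In finite dimension, a subspace and its orthogonal complement with respect to an inner product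
are complementary. -/
lemma InnerProductSpace.Core.isCompl_of_mem_iff {V : Type*} [AddCommGroup V] [Module ℂ V]
    [FiniteDimensional ℂ V] (c : InnerProductSpace.Core ℂ V) {O N : Submodule ℂ V}
    (hN : ∀ x, x ∈ N ↔ ∀ h ∈ O, c.inner h x = 0) : IsCompl O N := by
  let : NormedAddCommGroup V := c.toNormedAddCommGroup
  let : InnerProductSpace ℂ V := InnerProductSpace.ofCore c.toCore
  have : N = Oᗮ := by
    ext x
    rw [hN, Submodule.mem_orthogonal]
  rw [this]
  exact Submodule.isCompl_orthogonal O

/-- The density `1 / y ^ 2` is nowhere zero. This upgrades almost-everywhere vanishing of a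
continuous function to vanishing. -/
instance UpperHalfPlane.isOpenPosMeasure_volume : (volume : Measure ℍ).IsOpenPosMeasure where
  open_pos U hU hne h := by
    rw [volume_eq_lintegral, lintegral_eq_zero_iff (by fun_prop), Filter.EventuallyEq,
      ae_restrict_iff' (isOpenEmbedding_coe.isOpenMap U hU).measurableSet] at h
    refine (isOpenEmbedding_coe.isOpenMap U hU).measure_ne_zero volume (hne.image _)
      (measure_mono_null ?_ h)
    rintro _ ⟨z, hz, rfl⟩ hcon
    have := hcon ⟨z, hz, rfl⟩
    simp [z.im_ne_zero] at this

namespace AtkinLehner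

lemma neg_one_mem_Gamma0 (M : ℕ) : (-1 : SL(2, ℤ)) ∈ Gamma0 M := Gamma0_mem.mpr (by simp)

/-- Working in `GL(2, ℝ)` allows conjugation by the Atkin–Lehner matrix, which is not in `SL(2, ℤ)`.
-/
lemma permSubgroup_Gamma0 (M : ℕ) :
    permSubgroup (Gamma0 M) = (Gamma0GL M).map (MulAction.toPermHom (GL (Fin 2) ℝ) ℍ) := by
  rw [Gamma0GL, Subgroup.map_map]
  exact congrArg (fun φ => (Gamma0 M).map φ) (MonoidHom.ext fun g => Equiv.ext fun z => rfl)

lemma petersson_permSubgroup_smul {M : ℕ} {k : ℤ} (f g : CuspSpace M k)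
    (γ : permSubgroup (Gamma0 M)) (z : ℍ) : petersson k f g (γ • z) = petersson k f g z := by
  obtain ⟨γ, hγ, h⟩ := exists_permSubgroup_smul _ γ
  rw [h]
  exact SlashInvariantFormClass.petersson_smul (Γ := Gamma0GL M)
    (g := Matrix.SpecialLinearGroup.mapGL ℝ γ) ⟨γ, hγ, rfl⟩

lemma isFundamentalDomain_Gamma0 (M : ℕ) [NeZero M] :
    IsFundamentalDomain (permSubgroup (Gamma0 M)) (subgroupFd (Gamma0 M)) :=
  isFundamentalDomain_subgroupFd (neg_one_mem_Gamma0 M)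

lemma peterssonProduct_eq_setIntegral {M : ℕ} [NeZero M] {k : ℤ} (f g : CuspSpace M k) :
    peterssonProduct f g = ∫ τ in subgroupFd (Gamma0 M), petersson k f g τ := by
  let := Fintype.ofFinite (SL(2, ℤ) ⧸ Gamma0 M)
  rw [setIntegral_subgroupFd (neg_one_mem_Gamma0 M) (integrable_petersson f g)]
  exact peterssonProduct_eq_sum f g

lemma integrableOn_petersson_subgroupFd {M : ℕ} [NeZero M] {k : ℤ} (f g : CuspSpace M k) :
    IntegrableOn (petersson k f g) (subgroupFd (Gamma0 M)) := by
  let := Fintype.ofFinite (SL(2, ℤ) ⧸ Gamma0 M)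
  exact integrableOn_subgroupFd (integrable_petersson f g)

/-! ### Positivity of the Petersson product -/

lemma petersson_self {k : ℤ} (f : ℍ → ℂ) (z : ℍ) :
    petersson k f f z = ((‖f z‖ ^ 2 * z.im ^ k : ℝ) : ℂ) := by
  rw [petersson, Complex.conj_mul']
  push_cast
  rfl

lemma peterssonProduct_self {M : ℕ} [NeZero M] {k : ℤ} (f : CuspSpace M k) :
    peterssonProduct f f = ((∫ τ in subgroupFd (Gamma0 M), ‖f τ‖ ^ 2 * τ.im ^ k : ℝ) : ℂ) := by
  rw [peterssonProduct_eq_setIntegral, ← integral_complex_ofReal]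
  simp only [petersson_self]

lemma petersson_self_nonneg {k : ℤ} (f : ℍ → ℂ) (z : ℍ) : 0 ≤ ‖f z‖ ^ 2 * z.im ^ k :=
  mul_nonneg (sq_nonneg _) (zpow_nonneg z.im_pos.le k)

lemma eq_zero_of_peterssonProduct_self {M : ℕ} [NeZero M] {k : ℤ} {f : CuspSpace M k}
    (hf : peterssonProduct f f = 0) : f = 0 := by
  rw [peterssonProduct_self, Complex.ofReal_eq_zero] at hf
  have hint : IntegrableOn (fun τ : ℍ => ‖f τ‖ ^ 2 * τ.im ^ k) (subgroupFd (Gamma0 M)) := by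
    refine (integrableOn_petersson_subgroupFd f f).re.congr (ae_of_all _ fun τ => ?_)
    simp [petersson_self, -Complex.ofReal_mul]
  rw [setIntegral_eq_zero_iff_of_nonneg_ae (ae_of_all _ (petersson_self_nonneg f)) hint] at hf
  have hcont : Continuous (petersson k f f) :=
    petersson_continuous k (ModularFormClass.continuous f) (ModularFormClass.continuous f)
  -- The integrand vanishes almost everywhere on the fundamental domain; invariance spreads this to
  -- `ℍ`.
  have hzero : petersson k f f =ᵐ[volume] fun _ => 0 := by
    refine (isFundamentalDomain_Gamma0 M).measure_zero_of_invariant _ (fun γ => ?_) ?_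
    · ext z
      rw [Set.mem_smul_set_iff_inv_smul_mem]
      simp only [Set.mem_compl_iff, Set.mem_ofPred_eq, petersson_permSubgroup_smul]
    · change volume ((petersson k f f ⁻¹' {0})ᶜ ∩ _) = 0
      rw [← Measure.restrict_apply (hcont.measurable (measurableSet_singleton 0)).compl]
      filter_upwards [hf] with z hz
      change petersson k f f z = 0
      rw [petersson_self, hz]
      simp
  have h := Continuous.ae_eq_iff_eq volume hcont continuous_const |>.mp hzero
  refine DFunLike.ext _ _ fun z => ?_
  have hz := congrFun h z
  rw [petersson_self, Complex.ofReal_eq_zero] at hz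
  simpa [z.im_ne_zero, zpow_ne_zero] using hz

lemma peterssonProduct_conj {M : ℕ} [NeZero M] {k : ℤ} (f g : CuspSpace M k) :
    conj (peterssonProduct g f) = peterssonProduct f g := by
  rw [peterssonProduct_eq_setIntegral, peterssonProduct_eq_setIntegral, ← integral_conj]
  refine integral_congr_ae (ae_of_all _ fun τ => ?_)
  exact (petersson_symm k g f τ).symm

/-- The Petersson product as an inner product. -/
abbrev peterssonCore (M : ℕ) [NeZero M] (k : ℤ) : InnerProductSpace.Core ℂ (CuspSpace M k) where
  inner := peterssonProduct
  conj_inner_symm f g := peterssonProduct_conj f g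
  re_inner_nonneg f := by
    rw [peterssonProduct_self]
    exact integral_nonneg (petersson_self_nonneg f)
  add_left f g h := by
    rw [← peterssonProduct_conj, peterssonProduct_add, map_add, peterssonProduct_conj,
      peterssonProduct_conj]
  smul_left f g a := by
    rw [← peterssonProduct_conj, peterssonProduct_smul, map_mul, peterssonProduct_conj]
  definite f hf := eq_zero_of_peterssonProduct_self hf

/-! ### Unitarity of the Atkin-Lehner involution -/

variable (p N : ℕ) [Fact p.Prime] [NeZero N] (hpN : p.Coprime N) {k : ℤ}

instance neZero_prime : NeZero p := ⟨(Fact.out : p.Prime).ne_zero⟩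

-- As `w² = sγ₀` with `s` central, conjugation by `w⁻¹` is conjugation by `w` followed by
-- conjugation by `γ₀⁻¹`.
omit [NeZero N] in
lemma alMatrix_inv_conj {γ : GL (Fin 2) ℝ} (hγ : γ ∈ Gamma0GL (p * N)) :
    (alMatrix p N hpN)⁻¹ * γ * alMatrix p N hpN ∈ Gamma0GL (p * N) := by
  obtain ⟨γ₀, hγ₀, h⟩ := alMatrix_mul_self p N hpN
  set w := alMatrix p N hpN
  set s := Matrix.GeneralLinearGroup.scalar (Fin 2) (primeUnit p)
  have hs : ∀ g : GL (Fin 2) ℝ, s * g = g * s := Matrix.GeneralLinearGroup.scalar_commute _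
  have h1 : w = w⁻¹ * (s * γ₀) := by rw [← h, inv_mul_cancel_left]
  have h2 : w⁻¹ * γ * w = γ₀⁻¹ * (w * γ * w⁻¹) * γ₀ := by
    have h3 : w⁻¹ = γ₀⁻¹ * s⁻¹ * w := by
      rw [← mul_inv_rev, ← h]
      group
    calc w⁻¹ * γ * w = γ₀⁻¹ * s⁻¹ * w * γ * (w⁻¹ * (s * γ₀)) := by rw [← h1, ← h3]
      _ = γ₀⁻¹ * s⁻¹ * (w * γ * w⁻¹ * s) * γ₀ := by group
      _ = γ₀⁻¹ * (w * γ * w⁻¹) * γ₀ := by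
        rw [← hs]
        group
  rw [h2]
  exact mul_mem (mul_mem (inv_mem hγ₀) (alMatrix_conj p N hpN γ hγ)) hγ₀

/-- Substituting the Atkin-Lehner matrix does not change the integral of a `Γ₀(pN)`-invariant
function over `Γ₀(pN) \ ℍ`. -/
lemma setIntegral_alMatrix_smul {F : ℍ → ℂ}
    (hF : ∀ (γ : permSubgroup (Gamma0 (p * N))) (z : ℍ), F (γ • z) = F z) :
    ∫ τ in subgroupFd (Gamma0 (p * N)), F (alMatrix p N hpN • τ) =
      ∫ τ in subgroupFd (Gamma0 (p * N)), F τ := by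
  set w := alMatrix p N hpN
  set D := subgroupFd (Gamma0 (p * N))
  let φ := MulAction.toPermHom (GL (Fin 2) ℝ) ℍ
  have hmem : ∀ g : Equiv.Perm ℍ, g ∈ permSubgroup (Gamma0 (p * N)) ↔
      MulAut.conj (φ w⁻¹) g ∈ permSubgroup (Gamma0 (p * N)) := by
    intro g
    rw [permSubgroup_Gamma0, MulAut.conj_apply, ← map_inv, inv_inv]
    constructor
    · rintro ⟨γ, hγ, rfl⟩
      exact ⟨w⁻¹ * γ * w, alMatrix_inv_conj p N hpN hγ, by rw [map_mul, map_mul]⟩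
    · rintro ⟨γ, hγ, h⟩
      refine ⟨w * γ * w⁻¹, alMatrix_conj p N hpN γ hγ, ?_⟩
      change φ (w * γ * w⁻¹) = g
      rw [map_mul, map_mul, show φ γ = _ from h, map_inv]
      group
  -- Since `e g = w⁻¹gw` is a bijection of the group, the preimage of `D` under `w` is again a
  -- fundamental domain. The integral of the invariant function `F(wτ)` may be moved there, and `w`
  -- preserves the measure.
  let e := (MulAut.conj (φ w⁻¹)).toEquiv.subtypeEquiv hmem
  have he : ∀ (g : permSubgroup (Gamma0 (p * N))) (z : ℍ), w • (e g • z) = g • w • z := by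
    intro g z
    change w • (w⁻¹ • (g.1 ((φ w⁻¹)⁻¹ z))) = g.1 (w • z)
    rw [smul_inv_smul, ← map_inv, inv_inv]
    rfl
  have hmp := measurePreserving_smul w (volume : Measure ℍ)
  have hD : IsFundamentalDomain (permSubgroup (Gamma0 (p * N))) ((fun z : ℍ => w • z) ⁻¹' D) :=
    (isFundamentalDomain_Gamma0 (p * N)).preimage_of_equiv hmp.quasiMeasurePreserving e.bijective he
  rw [(isFundamentalDomain_Gamma0 (p * N)).setIntegral_eq hD
    (f := fun τ => F (w • τ)) fun γ z => ?_]
  · exact hmp.setIntegral_preimage_emb (measurableEmbedding_const_smul w) F D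
  · obtain ⟨g, rfl⟩ := e.surjective γ
    rw [he, hF]

lemma peterssonProduct_atkinLehner (hk : Even k) (f g : CuspSpace (p * N) k) :
    peterssonProduct (atkinLehner p N hpN k f) (atkinLehner p N hpN k g) =
      peterssonProduct f g := by
  rw [peterssonProduct_eq_setIntegral, peterssonProduct_eq_setIntegral,
    ← setIntegral_alMatrix_smul p N hpN (petersson_permSubgroup_smul f g)]
  refine integral_congr_ae (ae_of_all _ fun τ => ?_)
  have hp := prime_cast_ne_zero p
  have h := petersson_slash k f g (alMatrix p N hpN) τ
  rw [σ_of_det_pos (alMatrix_det_pos p N hpN), alMatrix_det, Nat.abs_cast,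
    Complex.ofReal_natCast] at h
  -- The normalisation of `W` is exactly what cancels the determinant factor `p ^ (k - 2)` in the
  -- slashed Petersson integrand.
  have hc : conj ((p : ℂ) ^ (1 - k / 2)) * (p : ℂ) ^ (1 - k / 2) * (p : ℂ) ^ (k - 2) = 1 := by
    rw [map_zpow₀, Complex.conj_natCast, ← zpow_add₀ hp, ← zpow_add₀ hp]
    obtain ⟨m, rfl⟩ := hk
    rw [show 1 - (m + m) / 2 + (1 - (m + m) / 2) + (m + m - 2) = 0 by omega, zpow_zero]
  have hs : ∀ (a : ℂ) (u v : ℍ → ℂ), petersson k (a • u) (a • v) τ =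
      conj a * a * petersson k u v τ := fun a u v => by
    simp only [petersson, Pi.smul_apply, smul_eq_mul, map_mul]
    ring
  change petersson k (atkinLehner p N hpN k f) (atkinLehner p N hpN k g) τ = _
  rw [coe_atkinLehner, coe_atkinLehner, hs, h, ← mul_assoc, hc, one_mul]

lemma atkinLehner_mem_pNew (hk : Even k) {f : CuspSpace (p * N) k} (hf : f ∈ pNew p N k) :
    atkinLehner p N hpN k f ∈ pNew p N k := by
  intro h hh
  rw [← atkinLehner_atkinLehner p N hpN hk h, peterssonProduct_atkinLehner p N hpN hk]
  exact hf _ (atkinLehner_mem_pOld p N hpN hk hh)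

lemma isCompl_pOld_pNew (k : ℤ) : IsCompl (pOld p N k) (pNew p N k) :=
  (peterssonCore (p * N) k).isCompl_of_mem_iff fun _ => Iff.rfl

end AtkinLehner
end
theorem mainTheorem7 (p N : ℕ) [Fact p.Prime] [NeZero N] (hpN : p.Coprime N)
    (k : ℤ) (hk : Even k) (hk0 : 0 < k) :
    FiniteDimensional ℂ (AtkinLehner.CuspSpace (p * N) k) ∧
    ∀ ε : ℂ, Module.End.HasEigenvalue (AtkinLehner.atkinLehner p N hpN k) ε →
      (Module.finrank ℂ ↥(AtkinLehner.pNew p N k ⊓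
          Module.End.eigenspace (AtkinLehner.atkinLehner p N hpN k) ε) : ℂ) =
        1 / 2 * ((Module.finrank ℂ ↥(AtkinLehner.pNew p N k) : ℂ) +
          ε * LinearMap.trace ℂ (AtkinLehner.CuspSpace (p * N) k)
            (AtkinLehner.atkinLehner p N hpN k)) := by
  refine ⟨inferInstance, fun ε hε => ?_⟩
  have hW := AtkinLehner.atkinLehner_atkinLehner p N hpN hk
  refine LinearMap.finrank_inf_eigenspace_of_involutive _ hW (AtkinLehner.isCompl_pOld_pNew p N k)
    (fun _ => AtkinLehner.atkinLehner_mem_pOld p N hpN hk)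
    (fun _ => AtkinLehner.atkinLehner_mem_pNew p N hpN hk)
    (AtkinLehner.trace_atkinLehner_pOld p N hpN hk) ?_
  -- A nonzero eigenvector `f` satisfies `ε²f = W(Wf) = f`, so `ε² = 1`.
  obtain ⟨f, hf⟩ := hε.exists_hasEigenvector
  have h := hW f
  rw [hf.apply_eq_smul, map_smul, hf.apply_eq_smul, smul_smul] at h
  exact smul_left_injective ℂ hf.2 (h.trans (one_smul ℂ f).symm)
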